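/- Let $\mathbb K\in\{\mathbb R,\mathbb C\}$. Topological vector spaces are over $\mathbb K$ and need not be Hausdorff. A Hausdorff topological space $X$ is a \emph{$k_\omega$-space} if there are compact subsets $K_1\subseteq K_2\subseteq\cdots$ of $X$ with $\bigcup_{n\ge 1} K_n=X$ such that a set $U\subseteq X$ is open if and only if $U\cap K_n$ is relatively open in $K_n$ for every $n$. For a topological vector space $F$, the convexification $F_{\mathrm{lcx}}$ is the vector space $F$ with the finest locally convex vector topology that is coarser than the given topology of $F$. A locally convex space $E$ satisfies the \emph{countable upper bound condition} if for every countable set $P$ of continuous seminorms on $E$ there is a continuous seminorm $q$ on $E$ such that for each $p\in P$ there is $C>0$ with $p\le C\,q$ pointwise. Let $E$ be a locally convex space. If $E$ is a $k_\omega$-space, or if $E=F_{\mathrm{lcx}}$ for some topological vector space $F$ which is a $k_\omega$-space, then $E$ satisfies the countable upper bound condition. -/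

import Mathlib

/-- A `k_ω`-space: a Hausdorff space `X` which is the union of an ascending sequence
`K 0 ⊆ K 1 ⊆ ⋯` of compact subsets and carries the direct limit topology: a set is open as soon
as its trace on every `K n` is relatively open. (A continuous injection from a compact space to a
Hausdorff space is an embedding, so that the compact spaces of such a sequence are automatically
subspaces of `X`.) -/
def IsKOmegaSpace (X : Type*) [TopologicalSpace X] : Prop :=
  T2Space X ∧ ∃ K : ℕ → Set X, Monotone K ∧ (∀ n, IsCompact (K n)) ∧ (⋃ n, K n) = Set.univ ∧
    Topology.IsCoherentWith (Set.range K)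

/-- The upper bound condition for the cardinal `θ`: every set of at most `θ` continuous seminorms
on `E` has an upper bound among the continuous seminorms, with respect to the preorder
`p ≼ q` iff `p ≤ C q` pointwise for some `C > 0`. -/
def UpperBoundCondition.{u, v} (𝕜 : Type u) (E : Type v) [RCLike 𝕜] [AddCommGroup E] [Module 𝕜 E]
    [TopologicalSpace E] (θ : Cardinal.{v}) : Prop :=
  ∀ P : Set (Seminorm 𝕜 E), (∀ p ∈ P, Continuous p) → Cardinal.mk P ≤ θ →
    ∃ q : Seminorm 𝕜 E, Continuous q ∧ ∀ p ∈ P, ∃ C : ℝ, 0 < C ∧ ∀ x, p x ≤ C * q x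

/-- The countable upper bound condition. -/
def CountableUpperBoundCondition (𝕜 E : Type*) [RCLike 𝕜] [AddCommGroup E] [Module 𝕜 E]
    [TopologicalSpace E] : Prop :=
  UpperBoundCondition 𝕜 E Cardinal.aleph0

/-- `t` is a vector topology on the `𝕜`-vector space `F`, that is, `(F, t)` is a topological
vector space over `𝕜` (not necessarily Hausdorff). -/
structure IsVectorTopology (𝕜 : Type*) {F : Type*} [RCLike 𝕜] [AddCommGroup F] [Module 𝕜 F]
    (t : TopologicalSpace F) : Prop where
  isTopologicalAddGroup : IsTopologicalAddGroup F
  continuousSMul : ContinuousSMul 𝕜 F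

/-- The topology of the convexification of a topological vector space `(F, t)`: the finest locally
convex vector topology which is coarser than `t`. In the order on `TopologicalSpace F`, `t ≤ s`
means that `s` is coarser than `t`; see `isLeast_convexification`. -/
abbrev convexification (𝕜 : Type*) {F : Type*} [RCLike 𝕜] [AddCommGroup F] [Module 𝕜 F] [Module ℝ F]
    (t : TopologicalSpace F) : TopologicalSpace F :=
  sInf {s | t ≤ s ∧ IsVectorTopology 𝕜 s ∧ @LocallyConvexSpace ℝ F _ _ _ _ s}

/-- The convexification is the finest element of the set of all locally convex vector topologies
coarser than the given topology. -/
theorem isLeast_convexification (𝕜 : Type*) {F : Type*} [RCLike 𝕜] [AddCommGroup F] [Module 𝕜 F]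
    [Module ℝ F] (t : TopologicalSpace F) :
    IsLeast {s : TopologicalSpace F |
      t ≤ s ∧ IsVectorTopology 𝕜 s ∧ @LocallyConvexSpace ℝ F _ _ _ _ s} (convexification 𝕜 t) := by
  refine ⟨⟨le_sInf fun s hs => hs.1, ⟨?_, ?_⟩, ?_⟩, fun s hs => sInf_le hs⟩
  · exact topologicalAddGroup_sInf fun s hs => hs.2.1.isTopologicalAddGroup
  · exact continuousSMul_sInf fun s hs => hs.2.1.continuousSMul
  · exact LocallyConvexSpace.sInf fun s hs => hs.2.2

/-! Given continuous seminorms `p n`, weights `ε n > 0` that decay fast enough make `q = ∑ ε n * p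
n` converge uniformly on each compact `K m`. Coherence then makes `q` continuous, and `p n ≤ (ε n)⁻¹
* q`. For a convexification, the sum is formed in the original topology, and `q`, being a seminorm,
stays continuous. -/

/-- On a `k_ω`-space, countably many continuous functions can be multiplied by positive constants
in such a way that their sum is continuous, and convergent at each point. -/
theorem IsKOmegaSpace.exists_pos_summable_continuous_tsum {X : Type*} [TopologicalSpace X]
    (hX : IsKOmegaSpace X) (f : ℕ → X → ℝ) (hf : ∀ n, Continuous (f n)) :
    ∃ ε : ℕ → ℝ, (∀ n, 0 < ε n) ∧ (∀ x, Summable fun n => ε n * f n x) ∧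
      Continuous fun x => ∑' n, ε n * f n x := by
  obtain ⟨-, K, hmono, hK, hunion, hcoh⟩ := hX
  have hbound : ∀ n m, ∃ C, ∀ x ∈ K m, ‖f n x‖ ≤ C := fun n m =>
    (hK m).exists_bound_of_continuousOn (hf n).continuousOn
  choose M hM using hbound
  -- Diagonal choice: `|ε n * f n| ≤ (1/2)^n` on `K n`, hence on every `K m` with `m ≤ n`.
  set ε : ℕ → ℝ := fun n => (1 / 2) ^ n / (1 + |M n n|)
  have hε : ∀ n, 0 < ε n := fun n => by positivity
  -- On `K m` only the finitely many `n < m` escape the geometric bound.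
  set u : ℕ → ℕ → ℝ := fun m n => if n < m then ε n * M n m else (1 / 2) ^ n
  have hu : ∀ m, Summable (u m) := fun m =>
    (summable_congr_atTop (Filter.eventually_atTop.2
      ⟨m, fun n hn => if_neg (not_lt.2 hn)⟩)).2 summable_geometric_two
  have hle : ∀ m n, ∀ x ∈ K m, ‖ε n * f n x‖ ≤ u m n := fun m n x hx => by
    rw [norm_mul, Real.norm_of_nonneg (hε n).le]
    by_cases hnm : n < m
    · simpa only [u, if_pos hnm] using mul_le_mul_of_nonneg_left (hM n m x hx) (hε n).le
    · have h : ‖f n x‖ ≤ 1 + |M n n| :=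
        (hM n n x (hmono (not_lt.1 hnm) hx)).trans ((le_abs_self _).trans (by linarith))
      simp only [u, if_neg hnm]
      calc ε n * ‖f n x‖ ≤ ε n * (1 + |M n n|) := mul_le_mul_of_nonneg_left h (hε n).le
        _ = (1 / 2) ^ n := div_mul_cancel₀ _ (by positivity)
  refine ⟨ε, hε, fun x => ?_, hcoh.continuous_iff.2 ?_⟩
  · obtain ⟨m, hm⟩ := Set.mem_iUnion.1 (hunion.symm ▸ Set.mem_univ x)
    exact .of_norm_bounded (hu m) fun n => hle m n x hm
  · rintro _ ⟨m, rfl⟩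
    exact continuousOn_tsum (fun n => ((hf n).const_mul _).continuousOn) (hu m) (hle m)

/-- A topological module which is a `k_ω`-space satisfies the countable upper bound condition. -/
theorem IsKOmegaSpace.countableUpperBoundCondition {𝕜 E : Type*} [RCLike 𝕜] [AddCommGroup E]
    [Module 𝕜 E] [TopologicalSpace E] (hE : IsKOmegaSpace E) :
    CountableUpperBoundCondition 𝕜 E := by
  intro P hP hcard
  rcases P.eq_empty_or_nonempty with rfl | hne
  · exact ⟨0, continuous_const, by simp⟩
  obtain ⟨p, rfl⟩ := (Cardinal.le_aleph0_iff_set_countable.1 hcard).exists_eq_range hne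
  obtain ⟨ε, hε, hsum, hcont⟩ := hE.exists_pos_summable_continuous_tsum (fun n => p n)
    fun n => hP _ ⟨n, rfl⟩
  refine ⟨Seminorm.of (fun x => ∑' n, ε n * p n x) (fun x y => ?_) (fun a x => ?_), hcont, ?_⟩
  · rw [← (hsum x).tsum_add (hsum y)]
    refine (hsum (x + y)).tsum_le_tsum (fun n => ?_) ((hsum x).add (hsum y))
    rw [← mul_add]
    exact mul_le_mul_of_nonneg_left (map_add_le_add (p n) x y) (hε n).le
  · simp only [map_smul_eq_mul, mul_left_comm (ε _) ‖a‖, tsum_mul_left]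
  · rintro _ ⟨n, rfl⟩
    refine ⟨(ε n)⁻¹, inv_pos.2 (hε n), fun x => (le_inv_mul_iff₀ (hε n)).2 ?_⟩
    exact (hsum x).le_tsum n fun i _ => mul_nonneg (hε i).le (apply_nonneg (p i) x)

/-- A seminorm which is continuous on a topological vector space is continuous on its
convexification. -/
theorem Seminorm.continuous_convexification {𝕜 F : Type*} [RCLike 𝕜] [AddCommGroup F]
    [Module 𝕜 F] [Module ℝ F] [IsScalarTower ℝ 𝕜 F] {t : TopologicalSpace F}
    (ht : IsVectorTopology 𝕜 t) (q : Seminorm 𝕜 F) (hq : @Continuous F ℝ t _ q) :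
    @Continuous F ℝ (convexification 𝕜 t) _ q := by
  -- The topology defined by `q` alone is locally convex and coarser than `t`, hence coarser than
  -- the convexification.
  let Q : SeminormFamily 𝕜 F Unit := fun _ => q
  let s : TopologicalSpace F := Q.moduleFilterBasis.topology
  have hQ : @WithSeminorms 𝕜 F Unit _ _ _ Q s := @WithSeminorms.mk 𝕜 F Unit _ _ _ Q s rfl
  have hts : t ≤ s := by
    have := @IsVectorTopology.isTopologicalAddGroup 𝕜 F _ _ _ t ht
    exact continuous_id_iff_le.1 <|
      @WithSeminorms.continuous_of_continuous_comp 𝕜 𝕜 F F Unit _ _ _ _ _ _ _ _ Q t _ s hQ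
        LinearMap.id fun _ => hq
  have hle : convexification 𝕜 t ≤ s := (isLeast_convexification 𝕜 t).2
    ⟨hts, ⟨@WithSeminorms.topologicalAddGroup 𝕜 F Unit _ _ _ s Q hQ,
      @WithSeminorms.continuousSMul 𝕜 F Unit _ _ _ s Q hQ⟩,
      @WithSeminorms.toLocallyConvexSpace 𝕜 F Unit _ _ _ _ _ _ s Q hQ⟩
  exact continuous_le_dom hle (@WithSeminorms.continuous_seminorm 𝕜 F Unit _ _ _ s Q hQ ())

theorem mainTheorem8 (𝕜 E : Type*) [RCLike 𝕜] [AddCommGroup E] [Module 𝕜 E] [Module ℝ E]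
    [IsScalarTower ℝ 𝕜 E] [tE : TopologicalSpace E] [IsTopologicalAddGroup E] [ContinuousSMul 𝕜 E]
    [LocallyConvexSpace ℝ E]
    (h : IsKOmegaSpace E ∨
      ∃ tF : TopologicalSpace E, IsVectorTopology 𝕜 tF ∧ @IsKOmegaSpace E tF ∧
        tE = convexification 𝕜 tF) :
    CountableUpperBoundCondition 𝕜 E := by
  rcases h with h | ⟨tF, htF, hF, rfl⟩
  · exact h.countableUpperBoundCondition
  · intro P hP hcard
    obtain ⟨q, hq, hPq⟩ := @IsKOmegaSpace.countableUpperBoundCondition 𝕜 E _ _ _ tF hF P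
      -- Passing to the finer topology `tF` keeps each `p` continuous.
      (fun p hp => continuous_le_dom (isLeast_convexification 𝕜 tF).1.1 (hP p hp)) hcard
    exact ⟨q, Seminorm.continuous_convexification htF q hq, hPq⟩
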